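/- A quantaloid $\mathcal{Q}$ is a category whose hom-sets $\mathcal{Q}(X,Y)$ are complete lattices and whose composition preserves arbitrary suprema in each variable; it is small if its objects and arrows form sets. An arrow $f\colon X\to Y$ of a quantaloid is a left adjoint if there is $f^*\colon Y\to X$ (then unique) with $1_X\le f^*\circ f$ and $f\circ f^*\le 1_Y$. A quantaloid is weakly tabular if every arrow $q\colon X\to Y$ satisfies $$q=\bigvee\{f\circ g^*\mid f\colon Z\to Y,\ g\colon Z\to X\text{ left adjoints with common domain},\ f\circ g^*\le q\},$$ and map-tabular if for every arrow $q\colon X\to Y$ there are left adjoints $f\colon Z\to Y$ and $g\colon Z\to X$ with $f\circ g^*=q$ and $(f^*\circ f)\wedge(g^*\circ g)=1_Z$. For a small quantaloid $\mathcal{Q}$, a $\mathcal{Q}$-category $\mathbb{A}$ is a set $\mathbb{A}_0$ with a type $ta\in\mathcal{Q}$ for each $a\in\mathbb{A}_0$ and arrows $\mathbb{A}(a',a)\colon ta\to ta'$ such that $1_{ta}\le\mathbb{A}(a,a)$ and $\mathbb{A}(a'',a')\circ\mathbb{A}(a',a)\le\mathbb{A}(a'',a)$. A distributor $\Phi$ from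 $\mathbb{A}$ to $\mathbb{B}$ consists of arrows $\Phi(b,a)\colon ta\to tb$ with $\mathbb{B}(b',b)\circ\Phi(b,a)\le\Phi(b',a)$ and $\Phi(b,a)\circ\mathbb{A}(a,a')\le\Phi(b,a')$. The quantaloid $\mathsf{Dist}(\mathcal{Q})$ has $\mathcal{Q}$-categories as objects and distributors, ordered elementwise, as arrows; composition is $(\Psi\otimes\Phi)(c,a)=\bigvee_{b\in\mathbb{B}_0}\Psi(c,b)\circ\Phi(b,a)$, and the identity on $\mathbb{A}$ is given by the arrows $\mathbb{A}(a',a)$. **Proposition.** A small quantaloid $\mathcal{Q}$ is weakly tabular if and only if $\mathsf{Dist}(\mathcal{Q})$ is map-tabular. -/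

import Mathlib

open CategoryTheory

universe u v

-- hom-sets are read through `CategoryStruct.toQuiver` only
attribute [-instance] catToReflQuiver

/-- A quantaloid: a category enriched in the monoidal closed category of complete lattices and
supremum-preserving maps, i.e. a category whose hom-sets are complete lattices and whose
composition preserves arbitrary suprema in each variable. -/
class Quantaloid (Q : Type u) extends Category.{v} Q where
  homLattice : ∀ X Y : Q, CompleteLattice (X ⟶ Y)
  sSup_comp : ∀ {X Y Z : Q} (S : Set (X ⟶ Y)) (g : Y ⟶ Z),
    (homLattice X Y).sSup S ≫ g = (homLattice X Z).sSup {h | ∃ f ∈ S, h = f ≫ g}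
  comp_sSup : ∀ {X Y Z : Q} (f : X ⟶ Y) (S : Set (Y ⟶ Z)),
    f ≫ (homLattice Y Z).sSup S = (homLattice X Z).sSup {h | ∃ g ∈ S, h = f ≫ g}

attribute [reducible, instance] Quantaloid.homLattice

namespace Quantaloid

section General

variable {Q : Type u} [Quantaloid.{u, v} Q]

/-- `Adj f f'` says that `f` is left adjoint to `f'` in the (locally ordered) quantaloid `Q`.
The right adjoint `f'` is determined by `f`; it is usually written `f^*`. -/
def Adj {X Y : Q} (f : X ⟶ Y) (f' : Y ⟶ X) : Prop :=
  𝟙 X ≤ f ≫ f' ∧ f' ≫ f ≤ 𝟙 Y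

variable (Q)

/-- Every `q : X ⟶ Y` is the supremum of all the arrows `f ∘ g^* ≤ q`, for `f : Z ⟶ Y` and
`g : Z ⟶ X` left adjoints with a common domain. -/
def WeaklyTabular : Prop :=
  ∀ (X Y : Q) (q : X ⟶ Y),
    q = sSup {p : X ⟶ Y | ∃ (Z : Q) (f : Z ⟶ Y) (f' : Y ⟶ Z) (g : Z ⟶ X) (g' : X ⟶ Z),
      Adj f f' ∧ Adj g g' ∧ p = g' ≫ f ∧ g' ≫ f ≤ q}

/-- For every `q : X ⟶ Y` there are left adjoints `f : Z ⟶ Y` and `g : Z ⟶ X` such that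
`f ∘ g^* = q` and `(f^* ∘ f) ⊓ (g^* ∘ g) = 𝟙 Z`. -/
def MapTabular : Prop :=
  ∀ (X Y : Q) (q : X ⟶ Y),
    ∃ (Z : Q) (f : Z ⟶ Y) (f' : Y ⟶ Z) (g : Z ⟶ X) (g' : X ⟶ Z),
      Adj f f' ∧ Adj g g' ∧ g' ≫ f = q ∧ (f ≫ f') ⊓ (g ≫ g') = 𝟙 Z

variable {Q}

theorem comp_mono {X Y Z : Q} {f f' : X ⟶ Y} {g g' : Y ⟶ Z} (hf : f ≤ f') (hg : g ≤ g') :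
    f ≫ g ≤ f' ≫ g' := by
  have h1 : f ≫ g ≤ f' ≫ g := by
    have h := sSup_comp {f, f'} g
    have e : sSup {f, f'} = f' := by rw [sSup_pair]; exact sup_eq_right.2 hf
    rw [e] at h
    rw [h]
    exact le_sSup ⟨f, by simp, rfl⟩
  have h2 : f' ≫ g ≤ f' ≫ g' := by
    have h := comp_sSup f' {g, g'}
    have e : sSup {g, g'} = g' := by rw [sSup_pair]; exact sup_eq_right.2 hg
    rw [e] at h
    rw [h]
    exact le_sSup ⟨g, by simp, rfl⟩
  exact h1.trans h2

theorem iSup_comp {ι : Sort*} {X Y Z : Q} (f : ι → (X ⟶ Y)) (g : Y ⟶ Z) :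
    (⨆ i, f i) ≫ g = ⨆ i, f i ≫ g := by
  refine (sSup_comp (Set.range f) g).trans (le_antisymm (sSup_le ?_) (iSup_le fun i => ?_))
  · rintro _ ⟨_, ⟨i, rfl⟩, rfl⟩
    exact le_iSup (fun i => f i ≫ g) i
  · exact le_sSup ⟨f i, ⟨i, rfl⟩, rfl⟩

theorem comp_iSup {ι : Sort*} {X Y Z : Q} (f : X ⟶ Y) (g : ι → (Y ⟶ Z)) :
    f ≫ (⨆ i, g i) = ⨆ i, f ≫ g i := by
  refine (comp_sSup f (Set.range g)).trans (le_antisymm (sSup_le ?_) (iSup_le fun i => ?_))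
  · rintro _ ⟨_, ⟨i, rfl⟩, rfl⟩
    exact le_iSup (fun i => f ≫ g i) i
  · exact le_sSup ⟨g i, ⟨i, rfl⟩, rfl⟩

end General

/-- A (small) category enriched in the quantaloid `Q`: a set of objects, each with a type in `Q`,
and hom-arrows `hom a' a : t a ⟶ t a'` satisfying the unit and composition inequalities. -/
structure EnrichedCat (Q : Type u) [Quantaloid.{u, u} Q] where
  Obj : Type u
  t : Obj → Q
  hom : ∀ a' a : Obj, t a ⟶ t a'
  one_le : ∀ a, 𝟙 (t a) ≤ hom a a
  comp_le : ∀ a'' a' a, hom a' a ≫ hom a'' a' ≤ hom a'' a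

/-- A distributor `A ⇸ B`: arrows `Φ b a : t a ⟶ t b` with actions of the homs of `A` and `B`. -/
@[ext]
structure Distributor {Q : Type u} [Quantaloid.{u, u} Q] (A B : EnrichedCat Q) where
  el : ∀ (b : B.Obj) (a : A.Obj), A.t a ⟶ B.t b
  act_left : ∀ b' b a, el b a ≫ B.hom b' b ≤ el b' a
  act_right : ∀ b a a', A.hom a a' ≫ el b a ≤ el b a'

namespace Distributor

variable {Q : Type u} [Quantaloid.{u, u} Q] {A B C D : EnrichedCat Q}

/-- Distributors are ordered elementwise. -/
instance : PartialOrder (Distributor A B) where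
  le Φ Ψ := ∀ b a, Φ.el b a ≤ Ψ.el b a
  le_refl _ _ _ := le_rfl
  le_trans _ _ _ h h' b a := (h b a).trans (h' b a)
  le_antisymm Φ Ψ h h' := by
    ext b a
    exact le_antisymm (h b a) (h' b a)

theorem le_def {Φ Ψ : Distributor A B} : Φ ≤ Ψ ↔ ∀ b a, Φ.el b a ≤ Ψ.el b a := Iff.rfl

/-- Elementwise supremum. -/
instance : SupSet (Distributor A B) where
  sSup S :=
    { el := fun b a => ⨆ Φ : S, Φ.1.el b a
      act_left := fun b' b a => by
        rw [iSup_comp]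
        exact iSup_mono fun Φ => Φ.1.act_left b' b a
      act_right := fun b a a' => by
        rw [comp_iSup]
        exact iSup_mono fun Φ => Φ.1.act_right b a a' }

/-- Elementwise binary infimum. -/
instance : Min (Distributor A B) where
  min Φ Ψ :=
    { el := fun b a => Φ.el b a ⊓ Ψ.el b a
      act_left := fun b' b a => le_inf
        ((comp_mono inf_le_left le_rfl).trans (Φ.act_left b' b a))
        ((comp_mono inf_le_right le_rfl).trans (Ψ.act_left b' b a))
      act_right := fun b a a' => le_inf
        ((comp_mono le_rfl inf_le_left).trans (Φ.act_right b a a'))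
        ((comp_mono le_rfl inf_le_right).trans (Ψ.act_right b a a')) }

theorem isLUB_sSup' (S : Set (Distributor A B)) : IsLUB S (sSup S) :=
  ⟨fun Φ hΦ b a => le_iSup (fun Ψ : S => Ψ.1.el b a) ⟨Φ, hΦ⟩,
    fun _ h b a => iSup_le fun Φ => h Φ.2 b a⟩

instance : CompleteLattice (Distributor A B) :=
  { completeLatticeOfSup (Distributor A B) isLUB_sSup' with
    inf := fun Φ Ψ => min Φ Ψ
    inf_le_left := fun _ _ _ _ => inf_le_left
    inf_le_right := fun _ _ _ _ => inf_le_right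
    le_inf := fun _ _ _ h h' b a => le_inf (h b a) (h' b a) }

theorem sSup_el (S : Set (Distributor A B)) (b : B.Obj) (a : A.Obj) :
    (sSup S).el b a = ⨆ Φ : S, Φ.1.el b a := rfl

theorem inf_el (Φ Ψ : Distributor A B) (b : B.Obj) (a : A.Obj) :
    (Φ ⊓ Ψ).el b a = Φ.el b a ⊓ Ψ.el b a := rfl

/-- The identity distributor on `A` has the hom-arrows of `A` as elements. -/
def one (A : EnrichedCat Q) : Distributor A A where
  el := A.hom
  act_left b' b a := A.comp_le b' b a
  act_right b a a' := A.comp_le b a a'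

/-- The composite `Ψ ⊗ Φ : A ⇸ C` of `Φ : A ⇸ B` and `Ψ : B ⇸ C`,
with elements `⋁_b Ψ(c, b) ∘ Φ(b, a)`. -/
def tensor (Φ : Distributor A B) (Ψ : Distributor B C) : Distributor A C where
  el c a := ⨆ b : B.Obj, Φ.el b a ≫ Ψ.el c b
  act_left c' c a := by
    rw [iSup_comp]
    refine iSup_mono fun b => ?_
    rw [Category.assoc]
    exact comp_mono le_rfl (Ψ.act_left c' c b)
  act_right c a a' := by
    rw [comp_iSup]
    refine iSup_mono fun b => ?_
    rw [← Category.assoc]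
    exact comp_mono (Φ.act_right b a a') le_rfl

theorem one_tensor (Φ : Distributor A B) : tensor (one A) Φ = Φ := by
  ext b a
  refine le_antisymm (iSup_le fun a' => Φ.act_right b a' a) ?_
  refine le_trans ?_ (le_iSup (fun a' => A.hom a' a ≫ Φ.el b a') a)
  simpa using comp_mono (A.one_le a) (le_refl (Φ.el b a))

theorem tensor_one (Φ : Distributor A B) : tensor Φ (one B) = Φ := by
  ext b a
  refine le_antisymm (iSup_le fun b' => Φ.act_left b b' a) ?_
  refine le_trans ?_ (le_iSup (fun b' => Φ.el b' a ≫ B.hom b b') b)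
  simpa using comp_mono (le_refl (Φ.el b a)) (B.one_le b)

theorem tensor_assoc (Φ : Distributor A B) (Ψ : Distributor B C) (Χ : Distributor C D) :
    tensor (tensor Φ Ψ) Χ = tensor Φ (tensor Ψ Χ) := by
  ext d a
  simp only [tensor, iSup_comp, comp_iSup, Category.assoc]
  exact iSup_comm

end Distributor

/-- The type of objects of the quantaloid `Dist(Q)`: all categories enriched in `Q`. -/
abbrev DistQ (Q : Type u) [Quantaloid.{u, u} Q] : Type (u + 1) := EnrichedCat Q

/-- The quantaloid `Dist(Q)` of `Q`-enriched categories and distributors. -/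
instance (Q : Type u) [Quantaloid.{u, u} Q] : Quantaloid.{u + 1, u} (DistQ Q) where
  Hom A B := Distributor (Q := Q) A B
  id A := Distributor.one A
  comp Φ Ψ := Distributor.tensor Φ Ψ
  id_comp := Distributor.one_tensor
  comp_id := Distributor.tensor_one
  assoc := Distributor.tensor_assoc
  homLattice A B := inferInstanceAs (CompleteLattice (Distributor (Q := Q) A B))
  sSup_comp := fun {A B C} S Ψ => by
    refine le_antisymm (fun c a => ?_) (sSup_le ?_)
    · refine iSup_le fun b => ?_
      rw [Distributor.sSup_el, iSup_comp]
      refine iSup_le fun Φ => ?_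
      refine le_trans (le_iSup (fun b => Φ.1.el b a ≫ Ψ.el c b) b) ?_
      exact (Distributor.isLUB_sSup' {h | ∃ Φ ∈ S, h = Distributor.tensor Φ Ψ}).1
        ⟨Φ.1, Φ.2, rfl⟩ c a
    · rintro _ ⟨Φ, hΦ, rfl⟩ c a
      exact iSup_mono fun b => comp_mono ((Distributor.isLUB_sSup' S).1 hΦ b a) le_rfl
  comp_sSup := fun {A B C} Φ S => by
    refine le_antisymm (fun c a => ?_) (sSup_le ?_)
    · refine iSup_le fun b => ?_
      rw [Distributor.sSup_el, comp_iSup]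
      refine iSup_le fun Ψ => ?_
      refine le_trans (le_iSup (fun b => Φ.el b a ≫ Ψ.1.el c b) b) ?_
      exact (Distributor.isLUB_sSup' {h | ∃ Ψ ∈ S, h = Distributor.tensor Φ Ψ}).1
        ⟨Ψ.1, Ψ.2, rfl⟩ c a
    · rintro _ ⟨Ψ, hΨ, rfl⟩ c a
      exact iSup_mono fun b => comp_mono le_rfl ((Distributor.isLUB_sSup' S).1 hΨ c b)

end Quantaloid

/-!
Suppose `Q` is weakly tabular and let `Φ : A ⇸ B` be a distributor. Take as objects of a category
`Φ.spanCat` all spans of left adjoints `f : Z ⟶ t b`, `g : Z ⟶ t a` with `f ∘ g^* ≤ Φ(b, a)`,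
the type of such a span being `Z`. A family of left adjoints from the types of `C` into the types
of `B` induces on its index set the largest hom-arrows `f_c'^* ∘ B(b_c', b_c) ∘ f_c`; whenever the
homs of `C` lie below these, the family is a functor up to change of type (`MapFunctor`), whose
graph in `Dist(Q)` is a left adjoint with `(graph^* ∘ graph)(c', c) = f_c'^* ∘ B(b_c', b_c) ∘ f_c`
(`MapFunctor.adj_graph`, `MapFunctor.graph_comp_cograph_el`). The homs of `Φ.spanCat` are the meets
of the two families so induced by the legs to `B` and to `A`, so the joint condition
`(F^* ∘ F) ⊓ (G^* ∘ G) = 1` holds by construction, while `F ∘ G^*` is the supremum of all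
`f ∘ g^* ≤ Φ(b, a)`, acted on by the homs of `A` and `B`; this is `Φ` by weak tabularity.

Conversely, read an arrow `q : X ⟶ Y` as a distributor between one-object categories
with identity homs. If `q = F ∘ G^*` in `Dist(Q)`, then every element of `F` and of `G` is a left
adjoint in `Q` (`adj_el`), and `q` is the supremum of the composites of these elements.
-/

namespace Quantaloid

namespace Distributor

variable {Q : Type u} [Quantaloid.{u, u} Q]

theorem le_comp_el {A B C : DistQ Q} (Φ : A ⟶ B) (Ψ : B ⟶ C) (c : C.Obj) (b : B.Obj)
    (a : A.Obj) :
    Distributor.el Φ b a ≫ Distributor.el Ψ c b ≤ Distributor.el (Φ ≫ Ψ) c a :=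
  le_iSup (fun b => Distributor.el Φ b a ≫ Distributor.el Ψ c b) b

end Distributor

/-! ### Spans of left adjoints below a distributor -/

section WeaklyTabularToMapTabular

variable {Q : Type u} [Quantaloid.{u, u} Q]

/-- A functor from `C` to `B` up to change of type: every object `c` is sent to an object `obj c`
together with a left adjoint `map c` from the type of `c` to the type of `obj c`, and the homs of
`C` lie below the homs of `B` transported along these left adjoints. The right adjoints `radj c`
are carried as data. -/
structure MapFunctor (C B : EnrichedCat Q) where
  obj : C.Obj → B.Obj
  map : ∀ c, C.t c ⟶ B.t (obj c)
  radj : ∀ c, B.t (obj c) ⟶ C.t c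
  adj : ∀ c, Adj (map c) (radj c)
  hom_le : ∀ c' c, C.hom c' c ≤ map c ≫ B.hom (obj c') (obj c) ≫ radj c'

/-- Hom-arrows transported along left adjoints satisfy the unit inequality. -/
theorem Adj.one_le_conj {X Y : Q} {f : X ⟶ Y} {f' : Y ⟶ X} (h : Adj f f') {k : Y ⟶ Y}
    (hk : 𝟙 Y ≤ k) : 𝟙 X ≤ f ≫ k ≫ f' :=
  h.1.trans (comp_mono le_rfl (by simpa using comp_mono hk (le_refl f')))

/-- In a composite, `f^*` followed by `f` may be cancelled. -/
theorem Adj.cancel_le {X Y W V : Q} {f : X ⟶ Y} {f' : Y ⟶ X} (h : Adj f f') (k : W ⟶ Y)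
    (l : Y ⟶ V) : (k ≫ f') ≫ f ≫ l ≤ k ≫ l := by
  simpa using comp_mono (le_refl k) (comp_mono h.2 (le_refl l))

namespace MapFunctor

variable {C B : EnrichedCat Q} (F : MapFunctor C B)

/-- The distributor `C ⇸ B` represented by `F`, with elements `B(b, F c) ∘ F_c`. -/
def graph : Distributor C B where
  el b c := F.map c ≫ B.hom b (F.obj c)
  act_left b' b c := by
    rw [Category.assoc]
    exact comp_mono le_rfl (B.comp_le _ _ _)
  act_right b c c' := by
    refine (comp_mono (F.hom_le c c') le_rfl).trans ?_
    rw [← Category.assoc (F.map c')]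
    refine ((F.adj c).cancel_le _ _).trans ?_
    rw [Category.assoc]
    exact comp_mono le_rfl (B.comp_le _ _ _)

/-- The distributor `B ⇸ C` corepresented by `F`, with elements `F_c^* ∘ B(F c, b)`. -/
def cograph : Distributor B C where
  el c b := B.hom (F.obj c) b ≫ F.radj c
  act_left c' c b := by
    refine (comp_mono le_rfl (F.hom_le c' c)).trans (((F.adj c).cancel_le _ _).trans ?_)
    rw [← Category.assoc]
    exact comp_mono (B.comp_le _ _ _) le_rfl
  act_right c b b' := by
    rw [← Category.assoc]
    exact comp_mono (B.comp_le _ _ _) le_rfl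

theorem graph_comp_cograph_el (c' c : C.Obj) :
    (F.graph.tensor F.cograph).el c' c =
      F.map c ≫ B.hom (F.obj c') (F.obj c) ≫ F.radj c' := by
  apply le_antisymm
  · refine iSup_le fun b => ?_
    have h := comp_mono (le_refl (F.map c)) (comp_mono
      (B.comp_le (F.obj c') b (F.obj c)) (le_refl (F.radj c')))
    simpa [graph, cograph] using h
  · refine le_trans ?_ (le_iSup (fun b => F.graph.el b c ≫ F.cograph.el c' b) (F.obj c'))
    have h := comp_mono (le_refl (F.map c ≫ B.hom (F.obj c') (F.obj c)))
      (comp_mono (B.one_le (F.obj c')) (le_refl (F.radj c')))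
    simpa [graph, cograph] using h

theorem adj_graph : Adj (Q := DistQ Q) (X := C) (Y := B) F.graph F.cograph := by
  constructor
  · intro c' c
    exact (F.hom_le c' c).trans (F.graph_comp_cograph_el c' c).ge
  · intro b' b
    exact iSup_le fun c => ((F.adj c).cancel_le _ _).trans (B.comp_le _ _ _)

end MapFunctor

namespace Distributor

variable {A B : EnrichedCat Q}

/-- A span of left adjoints `Z ⟶ t b`, `Z ⟶ t a`, with right adjoints carried as data, whose
composite lies below the element `Φ(b, a)` of the distributor `Φ`. -/
structure Span (Φ : Distributor A B) : Type u where
  a : A.Obj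
  b : B.Obj
  Z : Q
  f : Z ⟶ B.t b
  f' : B.t b ⟶ Z
  g : Z ⟶ A.t a
  g' : A.t a ⟶ Z
  adj_f : Adj f f'
  adj_g : Adj g g'
  comp_le : g' ≫ f ≤ Φ.el b a

/-- Homs transported along left adjoints compose. -/
theorem conj_comp_le {B : EnrichedCat Q} {b b' b'' : B.Obj} {Z Z' Z'' : Q} (f : Z ⟶ B.t b)
    {f₁ : Z' ⟶ B.t b'} {f₁' : B.t b' ⟶ Z'} (h : Adj f₁ f₁') (f₂' : B.t b'' ⟶ Z'') :
    (f ≫ B.hom b' b ≫ f₁') ≫ f₁ ≫ B.hom b'' b' ≫ f₂' ≤ f ≫ B.hom b'' b ≫ f₂' := by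
  have h1 := h.cancel_le (f ≫ B.hom b' b) (B.hom b'' b' ≫ f₂')
  have h2 := comp_mono (le_refl f) (comp_mono (B.comp_le b'' b' b) (le_refl f₂'))
  simp only [Category.assoc] at h1 h2 ⊢
  exact h1.trans h2

/-- The category of all spans below `Φ`, with the largest homs for which both legs are functors
up to change of type. -/
def spanCat (Φ : Distributor A B) : EnrichedCat Q where
  Obj := Span Φ
  t s := s.Z
  hom s' s := (s.f ≫ B.hom s'.b s.b ≫ s'.f') ⊓ (s.g ≫ A.hom s'.a s.a ≫ s'.g')
  one_le s := le_inf (s.adj_f.one_le_conj (B.one_le _)) (s.adj_g.one_le_conj (A.one_le _))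
  comp_le s'' s' s := le_inf
    ((comp_mono inf_le_left inf_le_left).trans (conj_comp_le s.f s'.adj_f s''.f'))
    ((comp_mono inf_le_right inf_le_right).trans (conj_comp_le s.g s'.adj_g s''.g'))

/-- The leg of the spans below `Φ` that lands in the codomain of `Φ`. -/
def spanCod (Φ : Distributor A B) : MapFunctor Φ.spanCat B where
  obj s := s.b
  map s := s.f
  radj s := s.f'
  adj s := s.adj_f
  hom_le _ _ := inf_le_left

/-- The leg of the spans below `Φ` that lands in the domain of `Φ`. -/
def spanDom (Φ : Distributor A B) : MapFunctor Φ.spanCat A where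
  obj s := s.a
  map s := s.g
  radj s := s.g'
  adj s := s.adj_g
  hom_le _ _ := inf_le_right

theorem spanDom_cograph_tensor_spanCod_graph_le (Φ : Distributor A B) :
    Φ.spanDom.cograph.tensor Φ.spanCod.graph ≤ Φ := by
  intro b a
  refine iSup_le fun s : Span Φ => ?_
  change (A.hom s.a a ≫ s.g') ≫ s.f ≫ B.hom b s.b ≤ Φ.el b a
  calc (A.hom s.a a ≫ s.g') ≫ s.f ≫ B.hom b s.b
      = A.hom s.a a ≫ (s.g' ≫ s.f) ≫ B.hom b s.b := by simp only [Category.assoc]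
    _ ≤ A.hom s.a a ≫ Φ.el b s.a :=
        comp_mono le_rfl ((comp_mono s.comp_le le_rfl).trans (Φ.act_left b s.b s.a))
    _ ≤ Φ.el b a := Φ.act_right b s.a a

theorem le_spanDom_cograph_tensor_spanCod_graph (hQ : WeaklyTabular Q) (Φ : Distributor A B) :
    Φ ≤ Φ.spanDom.cograph.tensor Φ.spanCod.graph := by
  intro b a
  rw [hQ _ _ (Φ.el b a)]
  refine sSup_le ?_
  rintro _ ⟨Z, f, f', g, g', hf, hg, rfl, hle⟩
  let s : Span Φ := ⟨a, b, Z, f, f', g, g', hf, hg, hle⟩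
  refine le_trans ?_
    (le_iSup (fun s : Span Φ => Φ.spanDom.cograph.el s a ≫ Φ.spanCod.graph.el b s) s)
  change g' ≫ f ≤ (A.hom a a ≫ g') ≫ f ≫ B.hom b b
  have h := comp_mono (comp_mono (A.one_le a) (le_refl g'))
    (comp_mono (le_refl f) (B.one_le b))
  simpa using h

end Distributor

theorem WeaklyTabular.mapTabular_distQ (hQ : WeaklyTabular Q) : MapTabular (DistQ Q) := by
  intro A B Φ
  let Ψ : Distributor A B := Φ
  refine ⟨Ψ.spanCat, Ψ.spanCod.graph, Ψ.spanCod.cograph, Ψ.spanDom.graph, Ψ.spanDom.cograph,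
    Ψ.spanCod.adj_graph, Ψ.spanDom.adj_graph, ?_, ?_⟩
  · exact le_antisymm Ψ.spanDom_cograph_tensor_spanCod_graph_le
      (Ψ.le_spanDom_cograph_tensor_spanCod_graph hQ)
  · apply Distributor.ext
    funext s' s
    exact congrArg₂ (· ⊓ ·) (Ψ.spanCod.graph_comp_cograph_el s' s)
      (Ψ.spanDom.graph_comp_cograph_el s' s)

end WeaklyTabularToMapTabular

/-! ### Distributors between one-object categories -/

section MapTabularToWeaklyTabular

variable {Q : Type u} [Quantaloid.{u, u} Q]

/-- The category with a single object, of type `X`, and the identity of `X` as hom-arrow. -/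
def EnrichedCat.single (X : Q) : EnrichedCat Q where
  Obj := PUnit
  t _ := X
  hom _ _ := 𝟙 X
  one_le _ := le_rfl
  comp_le _ _ _ := (Category.id_comp _).le

/-- An arrow of `Q` as a distributor between one-object categories. -/
def Distributor.ofHom {X Y : Q} (q : X ⟶ Y) :
    Distributor (EnrichedCat.single X) (EnrichedCat.single Y) where
  el _ _ := q
  act_left _ _ _ := (Category.comp_id _).le
  act_right _ _ _ := (Category.id_comp _).le

/-- The elements of a left adjoint distributor into a one-object category are left adjoints
in `Q`. -/
theorem adj_el {C : EnrichedCat Q} {Y : Q} {F : Distributor C (EnrichedCat.single Y)}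
    {F' : Distributor (EnrichedCat.single Y) C}
    (h : Adj (Q := DistQ Q) (X := C) (Y := EnrichedCat.single Y) F F') (c : C.Obj) :
    Adj (Q := Q) (X := C.t c) (Y := Y) (F.el PUnit.unit c) (F'.el c PUnit.unit) :=
  -- the supremum defining the unit runs over the single object of the codomain
  ⟨(C.one_le c).trans ((h.1 c c).trans (iSup_le fun _ => le_rfl)),
    (Distributor.le_comp_el F' F PUnit.unit c PUnit.unit).trans (h.2 PUnit.unit PUnit.unit)⟩

theorem weaklyTabular_of_mapTabular_distQ (hQ : MapTabular (DistQ Q)) : WeaklyTabular Q := by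
  intro X Y q
  obtain ⟨C, F, F', G, G', hF, hG, hq, -⟩ :=
    hQ (EnrichedCat.single X) (EnrichedCat.single Y) (Distributor.ofHom q)
  have hq' : (⨆ c : C.Obj, Distributor.el G' c PUnit.unit ≫ Distributor.el F PUnit.unit c) = q :=
    congrArg (fun Φ : Distributor (EnrichedCat.single X) (EnrichedCat.single Y) =>
      Φ.el PUnit.unit PUnit.unit) hq
  apply le_antisymm
  · refine hq'.ge.trans (iSup_le fun c => le_sSup ?_)
    exact ⟨C.t c, Distributor.el F PUnit.unit c, Distributor.el F' c PUnit.unit,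
      Distributor.el G PUnit.unit c, Distributor.el G' c PUnit.unit, adj_el hF c, adj_el hG c, rfl,
      (le_iSup (fun c : C.Obj =>
        Distributor.el G' c PUnit.unit ≫ Distributor.el F PUnit.unit c) c).trans hq'.le⟩
  · refine sSup_le ?_
    rintro _ ⟨Z, f, f', g, g', -, -, rfl, hle⟩
    exact hle

end MapTabularToWeaklyTabular

end Quantaloid

theorem proposition7 (Q : Type u) [Quantaloid.{u, u} Q] :
    Quantaloid.WeaklyTabular Q ↔ Quantaloid.MapTabular (Quantaloid.DistQ Q) :=
  ⟨fun h => h.mapTabular_distQ, Quantaloid.weaklyTabular_of_mapTabular_distQ⟩
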